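/- Let $q\ge 1$ and $d\ge 2$ be integers. Let $T$ be the $(q+1)$-regular tree, directed so that every vertex has a single predecessor and $q$ successors and every edge joins a vertex to its predecessor, with a basepoint $o$ and edges of length $1$; for vertices $v,w$ let $v\curlywedge w$ be their greatest common ancestor, and put $m(v)=d_T(o,o\curlywedge v)$, $l(v)=d_T(v,o\curlywedge v)$. The Diestel–Leader graph $DL_d(q)$ has as vertices the $d$-tuples $v=(v_1,\dots,v_d)$ of vertices of $T$ with $\sum_{i}(l(v_i)-m(v_i))=0$; two vertices $v,w$ are adjacent if there are $i\ne j$ such that $v_i,w_i$ are adjacent in $T$, $v_j,w_j$ are adjacent in $T$, and $v_k=w_k$ for all $k\notin\{i,j\}$. Let $d(\cdot,\cdot)$ be the graph distance of $DL_d(q)$, let $\mathrm{id}=(o,\dots,o)$, and put $m_i(v)=m(v_i)$ for $1\le i\le d$. A sequence $(x_n)$ of vertices of $DL_d(q)$ defines the horofunction $h:DL_d(q)\to\mathbb R$ if $h(z)=\lim_{n\to\infty}\bigl(d(x_n,z)-d(x_n,\mathrm{id})\bigr)$ for every vertex $z$; a horofunction is a function defined by some sequence in this way. (1) If a sequence $(x_n)$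 defines a horofunction, then for each $1\le i\le d$ the limit $\lim_n m_i(x_n)$ exists in $\mathbb Z_{\ge 0}\cup\{\infty\}$. (2) If sequences $(y_n)$ and $(z_n)$ define horofunctions $h_y$ and $h_z$ and there is an index $i$ with $\lim_n m_i(y_n)\ne\lim_n m_i(z_n)$, then $h_y\ne h_z$. (3) Consequently, for each horofunction $h$ and each $i$ there is a unique $m_i(h)\in\mathbb Z_{\ge 0}\cup\{\infty\}$ such that $\lim_n m_i(x_n)=m_i(h)$ for every sequence $(x_n)$ defining $h$. -/

import Mathlib

open Filter Topology

/-- A regular tree of valency `q + 1` on the vertex set `T`, directed so that each vertex `v` has a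
single predecessor `pred v` and `q` successors (the vertices whose predecessor is `v`). Every edge
joins a vertex to its predecessor. -/
structure DirectedRegularTree (q : ℕ) (T : Type*) where
  /-- The underlying graph. -/
  graph : SimpleGraph T
  isTree : graph.IsTree
  /-- The valency of every vertex is `q + 1`. -/
  valency : ∀ v, (graph.neighborSet v).encard = q + 1
  /-- The predecessor of a vertex. -/
  pred : T → T
  adj_iff : ∀ v w, graph.Adj v w ↔ w = pred v ∨ v = pred w
  /-- Every vertex has `q` successors. -/
  card_succ : ∀ v, {w | pred w = v}.encard = q

namespace DirectedRegularTree

variable {q : ℕ} {T : Type*} (𝒯 : DirectedRegularTree q T)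

/-- `u` is an ancestor of `v`: it is obtained from `v` by passing to the predecessor finitely many
times (possibly zero times). -/
def IsAncestor (u v : T) : Prop := ∃ n : ℕ, 𝒯.pred^[n] v = u

/-- `u` is a greatest common ancestor of `v` and `w`: it is a common ancestor of `v` and `w`, and
every common ancestor of `v` and `w` is an ancestor of `u`. -/
def IsGreatestCommonAncestor (v w u : T) : Prop :=
  𝒯.IsAncestor u v ∧ 𝒯.IsAncestor u w ∧
    ∀ u', 𝒯.IsAncestor u' v → 𝒯.IsAncestor u' w → 𝒯.IsAncestor u' u

theorem exists_common_ancestor (v w : T) : ∃ u, 𝒯.IsAncestor u v ∧ 𝒯.IsAncestor u w := by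
  obtain ⟨p⟩ := 𝒯.isTree.connected.preconnected v w
  induction p with
  | nil => exact ⟨_, ⟨0, rfl⟩, ⟨0, rfl⟩⟩
  | @cons a b c hab p ih =>
    obtain ⟨u, ⟨n, hn⟩, ⟨k, hk⟩⟩ := ih
    rcases (𝒯.adj_iff a b).1 hab with rfl | rfl
    · exact ⟨u, ⟨n + 1, by rw [Function.iterate_succ_apply, hn]⟩, ⟨k, hk⟩⟩
    · cases n with
      | zero =>
        refine ⟨𝒯.pred u, ⟨0, ?_⟩, ⟨k + 1, ?_⟩⟩
        · simpa using congrArg 𝒯.pred hn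
        · rw [Function.iterate_succ_apply', hk]
      | succ n => exact ⟨u, ⟨n, by rw [← hn, Function.iterate_succ_apply]⟩, ⟨k, hk⟩⟩

theorem exists_isGreatestCommonAncestor (v w : T) : ∃ u, 𝒯.IsGreatestCommonAncestor v w u := by
  classical
  have hex : ∃ n : ℕ, 𝒯.IsAncestor (𝒯.pred^[n] v) w := by
    obtain ⟨u, ⟨n, rfl⟩, hu⟩ := 𝒯.exists_common_ancestor v w
    exact ⟨n, hu⟩
  refine ⟨𝒯.pred^[Nat.find hex] v, ⟨_, rfl⟩, Nat.find_spec hex, ?_⟩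
  rintro u' ⟨k, rfl⟩ hk
  have hle : Nat.find hex ≤ k := Nat.find_min' hex hk
  refine ⟨k - Nat.find hex, ?_⟩
  rw [← Function.iterate_add_apply, Nat.sub_add_cancel hle]

/-- The greatest common ancestor `v ⋏ w` of two vertices of the tree. -/
noncomputable def gca (v w : T) : T := (𝒯.exists_isGreatestCommonAncestor v w).choose

theorem gca_spec (v w : T) : 𝒯.IsGreatestCommonAncestor v w (𝒯.gca v w) :=
  (𝒯.exists_isGreatestCommonAncestor v w).choose_spec

/-- `l(v) = d(v, o ⋏ v)`, where `o` is the basepoint of the tree. -/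
noncomputable def l (o v : T) : ℕ := 𝒯.graph.dist v (𝒯.gca o v)

/-- `m(v) = d(o, o ⋏ v)`, where `o` is the basepoint of the tree. -/
noncomputable def m (o v : T) : ℕ := 𝒯.graph.dist o (𝒯.gca o v)

/-- The height `h(v) = l(v) - m(v)`. -/
noncomputable def height (o v : T) : ℤ := (𝒯.l o v : ℤ) - (𝒯.m o v : ℤ)

theorem height_self (o : T) : 𝒯.height o o = 0 := by
  simp [height, l, m]

end DirectedRegularTree

/-- The vertices of the Diestel-Leader graph `DL_d(q)`: the `d`-tuples of vertices of the tree
(that is, of `d` copies of it, each with basepoint `o`) whose heights sum to `0`. -/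
@[ext]
structure DLVertex {q : ℕ} {T : Type*} (𝒯 : DirectedRegularTree q T) (o : T) (d : ℕ) where
  /-- The projection `p_i` of `DL_d(q)` to the `i`-th tree. -/
  proj : Fin d → T
  sum_height : ∑ i, 𝒯.height o (proj i) = 0

namespace DLVertex

variable {q : ℕ} {T : Type*} (𝒯 : DirectedRegularTree q T) (o : T) (d : ℕ)

/-- The basepoint `(o, …, o)` of `DL_d(q)`. -/
def base : DLVertex 𝒯 o d := ⟨fun _ => o, by simp [𝒯.height_self]⟩

/-- `m_i(v)` for a vertex `v` of `DL_d(q)`. -/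
noncomputable def m {𝒯 : DirectedRegularTree q T} {o : T} {d : ℕ} (i : Fin d)
    (v : DLVertex 𝒯 o d) : ℕ :=
  𝒯.m o (v.proj i)

end DLVertex

/-- The Diestel-Leader graph `DL_d(q)`: two vertices are joined by an edge if they are adjacent in
two of the trees and agree in all the others. -/
def DLGraph {q : ℕ} {T : Type*} (𝒯 : DirectedRegularTree q T) (o : T) (d : ℕ) :
    SimpleGraph (DLVertex 𝒯 o d) where
  Adj v w := ∃ i j : Fin d, i ≠ j ∧ 𝒯.graph.Adj (v.proj i) (w.proj i) ∧
    𝒯.graph.Adj (v.proj j) (w.proj j) ∧ ∀ k, k ≠ i → k ≠ j → v.proj k = w.proj k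
  symm := ⟨by
    rintro v w ⟨i, j, hij, hi, hj, hk⟩
    exact ⟨i, j, hij, hi.symm, hj.symm, fun k h1 h2 => (hk k h1 h2).symm⟩⟩
  loopless := ⟨by
    rintro v ⟨i, j, hij, hi, hj, hk⟩
    exact 𝒯.graph.irrefl hi⟩

/-- The sequence `x` in the connected graph `G` with basepoint `x₀` defines the horofunction `h`
(equivalently, `x` converges to `h`): `h z = lim (d(x_n, z) - d(x_n, x₀))` for every vertex `z`. -/
def DefinesHorofunction {V : Type*} (G : SimpleGraph V) (x₀ : V) (x : ℕ → V) (h : V → ℝ) : Prop :=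
  ∀ z, Tendsto (fun n => (G.dist (x n) z : ℝ) - (G.dist (x n) x₀ : ℝ)) atTop (𝓝 (h z))

/-- `h` is a horofunction of `G`: it is defined by some sequence of vertices. -/
def IsHorofunction {V : Type*} (G : SimpleGraph V) (x₀ : V) (h : V → ℝ) : Prop :=
  ∃ x : ℕ → V, DefinesHorofunction G x₀ x h

/-- `lim m_i(x_n) = M` in `ℤ_{≥ 0} ∪ {∞}`. -/
def HasMLimit {q : ℕ} {T : Type*} {𝒯 : DirectedRegularTree q T} {o : T} {d : ℕ}
    (i : Fin d) (x : ℕ → DLVertex 𝒯 o d) (M : ℕ∞) : Prop :=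
  Tendsto (fun n => ((x n).m i : ℕ∞)) atTop (𝓝 M)

/-! For fixed `i` and `n`, whether `m_i(x) ≤ n` can be read off from finitely many comparisons `d(x,
z) < d(x, z')` between fixed vertices (`exists_m_le_iff_dist_lt`). Distances are integers, so along
a sequence defining `h` such a comparison is eventually equivalent to `h z < h z'`. Hence `h` alone
decides, for every `n`, whether `m_i ≤ n` eventually holds. All three claims follow.

Call predecessors "up". For `q ≥ 2`, `m_i(x) ≤ n` says that `x_i` lies below `c`, the `n`-th
ancestor of `o`. Let `b` have height 0 and lie below a sibling `c'` of `c`. Then the basepoint is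
strictly closer to `x` than the vertex with `i`-th coordinate `b` and all others `o` exactly when
`x_i` lies below `c`. Both directions come from maps of a tree that commute with `pred` and act on
the whole graph without increasing distances (`dist_single_le`, `dist_base_lt`).

For `q = 1` there are no siblings, but the tree is a line and the distance is half the `ℓ¹` distance
of the height vectors, so explicit test vertices work. -/

namespace DirectedRegularTree

/-! ### Ancestors and heights in the directed tree. -/

variable {q : ℕ} {T : Type*} (𝒯 : DirectedRegularTree q T)

theorem adj_pred (v : T) : 𝒯.graph.Adj v (𝒯.pred v) := (𝒯.adj_iff _ _).2 (Or.inl rfl)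

theorem pred_ne (v : T) : 𝒯.pred v ≠ v := (𝒯.adj_pred v).ne'

/-- Otherwise the predecessor of `v` would also be a successor, leaving `q` neighbours instead of `q
+ 1`. -/
theorem pred_pred_ne (v : T) : 𝒯.pred (𝒯.pred v) ≠ v := by
  intro h
  have hset : 𝒯.graph.neighborSet v = {w | 𝒯.pred w = v} := by
    ext w
    simp only [SimpleGraph.mem_neighborSet, 𝒯.adj_iff, Set.mem_ofPred_eq]
    constructor
    · rintro (rfl | h')
      · exact h
      · exact h'.symm
    · exact fun h' => Or.inr h'.symm
  have h1 := 𝒯.valency v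
  rw [hset, 𝒯.card_succ] at h1
  have h2 : q = q + 1 := by exact_mod_cast h1
  omega

theorem exists_isPath_iterate_pred (v : T) (n : ℕ) :
    ∃ p : 𝒯.graph.Walk v (𝒯.pred^[n + 1] v),
      p.IsPath ∧ p.length = n + 1 ∧ p.penultimate = 𝒯.pred^[n] v := by
  induction n with
  | zero =>
    exact ⟨(𝒯.adj_pred v).toWalk, by simp [(𝒯.pred_ne v).symm], rfl, rfl⟩
  | succ n ih =>
    obtain ⟨p, hp, hlen, hpen⟩ := ih
    have hadj : 𝒯.graph.Adj (𝒯.pred^[n + 1] v) (𝒯.pred^[n + 2] v) := by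
      rw [Function.iterate_succ_apply' _ (n + 1)]
      exact 𝒯.adj_pred _
    refine ⟨p.concat hadj, hp.concat (fun hmem => ?_) hadj,
      by rw [SimpleGraph.Walk.length_concat, hlen], p.penultimate_concat hadj⟩
    -- In an acyclic graph a neighbour of the endpoint that lies on the path must be its penultimate
    -- vertex; this is why the induction carries that vertex along.
    have := 𝒯.isTree.isAcyclic.eq_penultimate_of_adj_end hp hadj hmem
    rw [hpen, Function.iterate_succ_apply', Function.iterate_succ_apply'] at this
    exact 𝒯.pred_pred_ne _ this

theorem dist_iterate_pred (v : T) (n : ℕ) : 𝒯.graph.dist v (𝒯.pred^[n] v) = n := by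
  cases n with
  | zero => simp
  | succ n =>
    obtain ⟨p, hp, hlen, -⟩ := 𝒯.exists_isPath_iterate_pred v n
    obtain ⟨r, hr, hrlen⟩ := 𝒯.isTree.connected.exists_path_of_dist v (𝒯.pred^[n + 1] v)
    obtain rfl : p = r := (𝒯.isTree.existsUnique_path _ _).unique hp hr
    omega

theorem iterate_pred_injective (v : T) : Function.Injective fun n => 𝒯.pred^[n] v := by
  intro n k h
  have := congrArg (𝒯.graph.dist v) h
  simpa [dist_iterate_pred] using this

theorem m_le_iff (o v : T) (n : ℕ) : 𝒯.m o v ≤ n ↔ 𝒯.IsAncestor (𝒯.pred^[n] o) v := by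
  obtain ⟨⟨b, hb⟩, ⟨a, ha⟩, hg⟩ := 𝒯.gca_spec o v
  have hm : 𝒯.m o v = b := by rw [m, ← hb, dist_iterate_pred]
  rw [hm]
  constructor
  · intro h
    refine ⟨n - b + a, ?_⟩
    rw [Function.iterate_add_apply, ha, ← hb, ← Function.iterate_add_apply, Nat.sub_add_cancel h]
  · intro h
    obtain ⟨j, hj⟩ := hg _ ⟨n, rfl⟩ h
    rw [← hb, ← Function.iterate_add_apply] at hj
    have := 𝒯.iterate_pred_injective o hj
    omega

/-- Any common ancestor computes the height, not only the greatest one: both ways of climbing from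
`v` to the ray above `o` can be prolonged to the same vertex, and iterates of `pred` never repeat.
-/
theorem height_eq_sub (o v : T) {a b : ℕ} (h : 𝒯.pred^[a] v = 𝒯.pred^[b] o) :
    𝒯.height o v = a - b := by
  obtain ⟨⟨b', hb⟩, ⟨a', ha⟩, -⟩ := 𝒯.gca_spec o v
  have hm : 𝒯.m o v = b' := by rw [m, ← hb, dist_iterate_pred]
  have hl : 𝒯.l o v = a' := by rw [l, ← ha, dist_iterate_pred]
  have key : 𝒯.pred^[b' + a] v = 𝒯.pred^[b + a'] v := by
    rw [Function.iterate_add_apply, h, Function.iterate_add_apply, ha, ← hb,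
      ← Function.iterate_add_apply, ← Function.iterate_add_apply, add_comm]
  have := 𝒯.iterate_pred_injective v key
  rw [height, hm, hl]
  omega

theorem height_pred (o v : T) : 𝒯.height o (𝒯.pred v) = 𝒯.height o v - 1 := by
  obtain ⟨u, ⟨a, ha⟩, ⟨b, hb⟩⟩ := 𝒯.exists_common_ancestor (𝒯.pred v) o
  rw [𝒯.height_eq_sub o (𝒯.pred v) (ha.trans hb.symm),
    𝒯.height_eq_sub o v (a := a + 1) (b := b)
      (by rw [Function.iterate_succ_apply, ha, hb])]
  push_cast
  ring

theorem height_iterate_pred (o v : T) (n : ℕ) :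
    𝒯.height o (𝒯.pred^[n] v) = 𝒯.height o v - n := by
  induction n with
  | zero => simp
  | succ n ih =>
    rw [Function.iterate_succ_apply', height_pred, ih]
    push_cast
    ring

theorem exists_iterate_pred_eq {o v w : T} (h : 𝒯.height o v = 𝒯.height o w) :
    ∃ n, 𝒯.pred^[n] v = 𝒯.pred^[n] w := by
  obtain ⟨u, ⟨a, ha⟩, ⟨b, hb⟩⟩ := 𝒯.exists_common_ancestor v w
  have h1 := congrArg (𝒯.height o) (ha.trans hb.symm)
  rw [height_iterate_pred, height_iterate_pred] at h1
  obtain rfl : a = b := by omega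
  exact ⟨a, ha.trans hb.symm⟩

theorem ne_zero_of_vertex {q : ℕ} (𝒯 : DirectedRegularTree q T) (v : T) : q ≠ 0 := by
  rintro rfl
  have h := 𝒯.card_succ (𝒯.pred v)
  have : v ∈ {w | 𝒯.pred w = 𝒯.pred v} := rfl
  simp only [Nat.cast_zero, Set.encard_eq_zero] at h
  rw [h] at this
  exact this

theorem pred_surjective : Function.Surjective 𝒯.pred := by
  intro v
  have h : {w | 𝒯.pred w = v}.encard ≠ 0 := by
    rw [𝒯.card_succ]
    exact_mod_cast 𝒯.ne_zero_of_vertex v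
  exact Set.nonempty_of_encard_ne_zero h

/-- A chosen successor of a vertex. -/
noncomputable def succ (v : T) : T := Function.surjInv 𝒯.pred_surjective v

theorem pred_succ (v : T) : 𝒯.pred (𝒯.succ v) = v := Function.surjInv_eq 𝒯.pred_surjective v

theorem height_succ (o v : T) : 𝒯.height o (𝒯.succ v) = 𝒯.height o v + 1 := by
  have := 𝒯.height_pred o (𝒯.succ v)
  rw [pred_succ] at this
  omega

theorem height_iterate_succ (o v : T) (n : ℕ) :
    𝒯.height o (𝒯.succ^[n] v) = 𝒯.height o v + n := by
  induction n with
  | zero => simp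
  | succ n ih =>
    rw [Function.iterate_succ_apply', height_succ, ih]
    push_cast
    ring

theorem iterate_pred_iterate_succ (v : T) (n : ℕ) : 𝒯.pred^[n] (𝒯.succ^[n] v) = v :=
  (Function.LeftInverse.iterate 𝒯.pred_succ n) v

theorem adj_succ (v : T) : 𝒯.graph.Adj v (𝒯.succ v) :=
  (𝒯.adj_iff _ _).2 (Or.inr (𝒯.pred_succ v).symm)

theorem exists_ne_pred_eq (hq : q ≠ 1) (c : T) : ∃ c', c' ≠ c ∧ 𝒯.pred c' = 𝒯.pred c := by
  have h : 1 < {w | 𝒯.pred w = 𝒯.pred c}.encard := by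
    rw [𝒯.card_succ]
    have := 𝒯.ne_zero_of_vertex c
    exact_mod_cast (by omega : 1 < q)
  obtain ⟨c', hc', hne⟩ := Set.exists_ne_of_one_lt_encard h c
  exact ⟨c', hne, hc'⟩

theorem pred_injective_of_one (𝒯 : DirectedRegularTree 1 T) : Function.Injective 𝒯.pred := by
  intro v w h
  have h1 := 𝒯.card_succ (𝒯.pred w)
  obtain ⟨a, ha⟩ := Set.encard_eq_one.1 (by simpa using h1)
  have hv : v ∈ {x | 𝒯.pred x = 𝒯.pred w} := h
  have hw : w ∈ {x | 𝒯.pred x = 𝒯.pred w} := rfl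
  rw [ha] at hv hw
  exact hv.trans hw.symm

theorem height_injective_of_one (𝒯 : DirectedRegularTree 1 T) (o : T) :
    Function.Injective (𝒯.height o) := by
  intro v w h
  obtain ⟨n, hn⟩ := 𝒯.exists_iterate_pred_eq h
  exact 𝒯.pred_injective_of_one.iterate n hn

/-! ### Lines and folding maps in the tree. -/

/-- A bi-infinite descending line through `b`, parametrised by the height over `b`. -/
noncomputable def line (b : T) (n : ℤ) : T := 𝒯.succ^[n.toNat] (𝒯.pred^[(-n).toNat] b)

theorem pred_line (b : T) (n : ℤ) : 𝒯.pred (𝒯.line b n) = 𝒯.line b (n - 1) := by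
  rcases le_or_gt n 0 with h | h
  · have h1 : n.toNat = 0 := by omega
    have h2 : (n - 1).toNat = 0 := by omega
    have h3 : (-(n - 1)).toNat = (-n).toNat + 1 := by omega
    simp only [line, h1, h2, h3, Function.iterate_zero, id, Function.iterate_succ_apply']
  · have h1 : n.toNat = (n - 1).toNat + 1 := by omega
    have h2 : (-n).toNat = 0 := by omega
    have h3 : (-(n - 1)).toNat = 0 := by omega
    simp only [line, h1, h2, h3, Function.iterate_succ_apply', pred_succ]

theorem line_neg_natCast (b : T) (n : ℕ) : 𝒯.line b (-n) = 𝒯.pred^[n] b := by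
  simp [line]

theorem line_zero (b : T) : 𝒯.line b 0 = b := by simp [line]

theorem height_line (o b : T) (n : ℤ) : 𝒯.height o (𝒯.line b n) = 𝒯.height o b + n := by
  rw [line, height_iterate_succ, height_iterate_pred]
  omega

theorem IsAncestor.of_pred {𝒯 : DirectedRegularTree q T} {c v : T}
    (h : 𝒯.IsAncestor c (𝒯.pred v)) : 𝒯.IsAncestor c v := by
  obtain ⟨n, hn⟩ := h
  exact ⟨n + 1, hn⟩

theorem IsAncestor.pred_or_eq {𝒯 : DirectedRegularTree q T} {c v : T}
    (h : 𝒯.IsAncestor c v) : 𝒯.IsAncestor c (𝒯.pred v) ∨ c = v := by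
  obtain ⟨n, hn⟩ := h
  cases n with
  | zero => exact Or.inr hn.symm
  | succ n => exact Or.inl ⟨n, hn⟩

theorem IsAncestor.eq_of_height_eq {𝒯 : DirectedRegularTree q T} {o c c' v : T}
    (h : 𝒯.IsAncestor c v) (h' : 𝒯.IsAncestor c' v) (hh : 𝒯.height o c = 𝒯.height o c') :
    c = c' := by
  obtain ⟨n, rfl⟩ := h
  obtain ⟨k, rfl⟩ := h'
  rw [height_iterate_pred, height_iterate_pred] at hh
  obtain rfl : n = k := by omega
  rfl

theorem not_isAncestor_pred (c : T) : ¬ 𝒯.IsAncestor c (𝒯.pred c) := by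
  rintro ⟨n, hn⟩
  have := 𝒯.iterate_pred_injective c (a₁ := n + 1) (a₂ := 0) hn
  omega

/-- Leaving the set of descendants of `c` along an edge is only possible at `c`. -/
theorem IsAncestor.exit {𝒯 : DirectedRegularTree q T} {c v w : T} (h : 𝒯.IsAncestor c v)
    (hw : ¬ 𝒯.IsAncestor c w) (hadj : 𝒯.graph.Adj v w) : v = c ∧ w = 𝒯.pred c := by
  rcases (𝒯.adj_iff v w).1 hadj with rfl | rfl
  · rcases h.pred_or_eq with h | rfl
    · exact absurd h hw
    · exact ⟨rfl, rfl⟩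
  · exact absurd h.of_pred hw

open Classical in
/-- The map folding the descendants of `c` onto the line through `b` and fixing all other
vertices. -/
noncomputable def fold (o c b v : T) : T :=
  if 𝒯.IsAncestor c v then 𝒯.line b (𝒯.height o v) else v

theorem fold_of_not_isAncestor {o c b v : T} (h : ¬ 𝒯.IsAncestor c v) :
    𝒯.fold o c b v = v := if_neg h

theorem fold_of_isAncestor {o c b v : T} (h : 𝒯.IsAncestor c v) :
    𝒯.fold o c b v = 𝒯.line b (𝒯.height o v) := if_pos h

theorem height_fold {o c b : T} (hb : 𝒯.height o b = 0) (v : T) :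
    𝒯.height o (𝒯.fold o c b v) = 𝒯.height o v := by
  rw [fold]
  split_ifs
  · rw [height_line, hb, zero_add]
  · rfl

/-- The only place where the two branches of `fold` meet is the edge from `c` to its predecessor;
`hbc` says that the line through `b` joins the unfolded part at that same predecessor. -/
theorem fold_pred {o c b : T} {n : ℕ} (hc : 𝒯.height o c = -n)
    (hbc : 𝒯.pred^[n + 1] b = 𝒯.pred c) (v : T) :
    𝒯.fold o c b (𝒯.pred v) = 𝒯.pred (𝒯.fold o c b v) := by
  by_cases h : 𝒯.IsAncestor c v
  · rcases h.pred_or_eq with h' | rfl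
    · rw [fold_of_isAncestor _ h, fold_of_isAncestor _ h', pred_line, height_pred]
    · rw [fold_of_isAncestor _ h, fold_of_not_isAncestor _ (𝒯.not_isAncestor_pred c), hc,
        line_neg_natCast, ← hbc, Function.iterate_succ_apply']
  · rw [fold_of_not_isAncestor _ h, fold_of_not_isAncestor _ fun h' => h h'.of_pred]

end DirectedRegularTree

/-! ### Geodesics and distance-nonincreasing maps. -/

namespace SimpleGraph

variable {V : Type*} {G : SimpleGraph V}

/-- A geodesic leaving a set of vertices crosses its boundary along an edge. -/
theorem Connected.exists_adj_dist_add_le (hG : G.Connected) (P : V → Prop) {x z : V}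
    (hx : P x) (hz : ¬ P z) :
    ∃ a b, P a ∧ ¬ P b ∧ G.Adj a b ∧ G.dist x a + 1 + G.dist b z ≤ G.dist x z := by
  obtain ⟨p, hp⟩ := hG.exists_walk_length_eq_dist x z
  rw [← hp]
  clear hp
  induction p with
  | nil => exact absurd hx hz
  | @cons u v w huv p ih =>
    by_cases hv : P v
    · obtain ⟨a, b, ha, hb, hab, hle⟩ := ih hv hz
      refine ⟨a, b, ha, hb, hab, ?_⟩
      have h1 := hG.dist_triangle (u := u) (v := v) (w := a)
      have h2 := dist_eq_one_iff_adj.2 huv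
      rw [Walk.length_cons]
      omega
    · refine ⟨u, v, hx, hv, huv, ?_⟩
      have := dist_le p
      rw [Walk.length_cons, dist_self]
      omega

theorem Connected.dist_map_le (hG : G.Connected) (f : G →g G) (x z : V) :
    G.dist (f x) (f z) ≤ G.dist x z := by
  obtain ⟨p, hp⟩ := hG.exists_walk_length_eq_dist x z
  rw [← hp, ← Walk.length_map f p]
  exact dist_le _

end SimpleGraph

/-! ### Connectedness of the Diestel–Leader graph and height estimates. -/

namespace DLVertex

variable {q : ℕ} {T : Type*} {𝒯 : DirectedRegularTree q T} {o : T} {d : ℕ}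

/-- The coordinatewise action on `DL_d(q)` of maps of the trees commuting with `pred`. -/
def map (F : Fin d → T → T) (hF : ∀ k v, F k (𝒯.pred v) = 𝒯.pred (F k v))
    (hs : ∀ v : DLVertex 𝒯 o d, ∑ k, 𝒯.height o (F k (v.proj k)) = 0) :
    DLGraph 𝒯 o d →g DLGraph 𝒯 o d where
  toFun v := ⟨fun k => F k (v.proj k), hs v⟩
  map_rel' := by
    have hadj : ∀ k v w, 𝒯.graph.Adj v w → 𝒯.graph.Adj (F k v) (F k w) := by
      intro k v w h
      rcases (𝒯.adj_iff v w).1 h with rfl | rfl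
      · rw [hF]; exact 𝒯.adj_pred _
      · rw [hF]; exact (𝒯.adj_pred _).symm
    rintro v w ⟨i, j, hij, hi, hj, hk⟩
    exact ⟨i, j, hij, hadj _ _ _ hi, hadj _ _ _ hj, fun k h1 h2 => congrArg (F k) (hk k h1 h2)⟩

/-- A sum of heights that arises from that of a vertex by changes at two coordinates. -/
theorem sum_height_add_ite (v : DLVertex 𝒯 o d) (f : Fin d → ℤ) (i j : Fin d) (a b : ℤ)
    (h : ∀ k, f k = 𝒯.height o (v.proj k) + ((if k = i then a else 0) + if k = j then b else 0)) :
    ∑ k, f k = a + b := by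
  simp [h, Finset.sum_add_distrib, v.sum_height]

/-- Moving the `i`-th coordinate `t` steps up and the `j`-th coordinate `t` steps down. -/
noncomputable def shift (v : DLVertex 𝒯 o d) {i j : Fin d} (hij : i ≠ j) (t : ℕ) :
    DLVertex 𝒯 o d where
  proj k := if k = i then 𝒯.pred^[t] (v.proj k) else
    if k = j then 𝒯.succ^[t] (v.proj k) else v.proj k
  sum_height := by
    rw [v.sum_height_add_ite _ i j (-t) t, neg_add_cancel]
    intro k
    split_ifs with h1 h2
    · exact absurd (h1.symm.trans h2) hij
    · rw [𝒯.height_iterate_pred]; ring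
    · rw [𝒯.height_iterate_succ]; ring
    · simp

theorem height_shift (v : DLVertex 𝒯 o d) {i j : Fin d} (hij : i ≠ j) (t : ℕ) (k : Fin d) :
    𝒯.height o ((v.shift hij t).proj k) =
      𝒯.height o (v.proj k) + ((if k = i then -(t : ℤ) else 0) + if k = j then (t : ℤ) else 0) := by
  simp only [shift]
  split_ifs with h1 h2
  · exact absurd (h1.symm.trans h2) hij
  · rw [𝒯.height_iterate_pred]; ring
  · rw [𝒯.height_iterate_succ]; ring
  · simp

theorem shift_zero (v : DLVertex 𝒯 o d) {i j : Fin d} (hij : i ≠ j) : v.shift hij 0 = v := by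
  ext k
  simp [shift]

theorem adj_shift_succ (v : DLVertex 𝒯 o d) {i j : Fin d} (hij : i ≠ j) (t : ℕ) :
    (DLGraph 𝒯 o d).Adj (v.shift hij t) (v.shift hij (t + 1)) := by
  refine ⟨i, j, hij, ?_, ?_, fun k h1 h2 => by simp [shift, h1, h2]⟩
  · simp only [shift, if_true, Function.iterate_succ_apply']
    exact 𝒯.adj_pred _
  · simp only [shift, hij.symm, if_true, if_false, Function.iterate_succ_apply']
    exact 𝒯.adj_succ _

theorem reachable_shift (v : DLVertex 𝒯 o d) {i j : Fin d} (hij : i ≠ j) (t : ℕ) :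
    (DLGraph 𝒯 o d).Reachable v (v.shift hij t) := by
  induction t with
  | zero => rw [shift_zero]
  | succ t ih => exact ih.trans (v.adj_shift_succ hij t).reachable

/-- Greedy descent: both height vectors sum to zero, so unless they agree some coordinate is too
high and another too low. Correcting both by one edge lowers the `ℓ¹` distance by 2. -/
theorem exists_walk_height_eq (v w : DLVertex 𝒯 o d) :
    ∃ v' : DLVertex 𝒯 o d, (∀ k, 𝒯.height o (v'.proj k) = 𝒯.height o (w.proj k)) ∧
      ∃ p : (DLGraph 𝒯 o d).Walk v v',
        2 * (p.length : ℤ) = ∑ k, |𝒯.height o (v.proj k) - 𝒯.height o (w.proj k)| := by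
  obtain ⟨n, hn⟩ : ∃ n : ℕ, (∑ k, |𝒯.height o (v.proj k) - 𝒯.height o (w.proj k)|).toNat = n :=
    ⟨_, rfl⟩
  induction n using Nat.strong_induction_on generalizing v with
  | _ n ih =>
  by_cases hall : ∀ k, 𝒯.height o (v.proj k) = 𝒯.height o (w.proj k)
  · exact ⟨v, hall, .nil, by simp [hall]⟩
  push Not at hall
  obtain ⟨k, hk⟩ := hall
  obtain ⟨i, -, hi⟩ := Finset.exists_pos_of_sum_zero_of_exists_nonzero (s := Finset.univ)
    (fun k => 𝒯.height o (v.proj k) - 𝒯.height o (w.proj k))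
    (by simp [v.sum_height, w.sum_height]) ⟨k, Finset.mem_univ k, sub_ne_zero.2 hk⟩
  obtain ⟨j, -, hj⟩ := Finset.exists_pos_of_sum_zero_of_exists_nonzero (s := Finset.univ)
    (fun k => 𝒯.height o (w.proj k) - 𝒯.height o (v.proj k))
    (by simp [v.sum_height, w.sum_height]) ⟨k, Finset.mem_univ k, sub_ne_zero.2 hk.symm⟩
  have hij : i ≠ j := by
    rintro rfl
    linarith
  have hadj : (DLGraph 𝒯 o d).Adj v (v.shift hij 1) := by
    simpa [shift_zero] using v.adj_shift_succ hij 0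
  have hsum : ∑ k, |𝒯.height o (v.proj k) - 𝒯.height o (w.proj k)| =
      ∑ k, |𝒯.height o ((v.shift hij 1).proj k) - 𝒯.height o (w.proj k)| + 2 := by
    have : ∀ k, |𝒯.height o (v.proj k) - 𝒯.height o (w.proj k)| =
        |𝒯.height o ((v.shift hij 1).proj k) - 𝒯.height o (w.proj k)| +
          ((if k = i then 1 else 0) + if k = j then 1 else 0) := by
      intro k
      rw [height_shift]
      split_ifs with h1 h2 h2
      · exact absurd (h1.symm.trans h2) hij
      · subst h1
        rw [abs_of_pos hi, abs_of_nonneg (by push_cast; omega)]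
        push_cast
        ring
      · subst h2
        rw [abs_of_neg (by omega), abs_of_nonpos (by push_cast; omega)]
        push_cast
        ring
      · simp
    simp [this, Finset.sum_add_distrib]
  have hpos : 0 ≤ ∑ k, |𝒯.height o ((v.shift hij 1).proj k) - 𝒯.height o (w.proj k)| :=
    Finset.sum_nonneg fun _ _ => abs_nonneg _
  obtain ⟨v', hv', p, hp⟩ := ih _ (by omega) (v.shift hij 1) rfl
  refine ⟨v', hv', .cons hadj p, ?_⟩
  rw [hsum, ← hp, SimpleGraph.Walk.length_cons]
  push_cast
  ring

theorem sum_abs_sub_le (v w : DLVertex 𝒯 o d) (p : (DLGraph 𝒯 o d).Walk v w) :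
    ∑ k, |𝒯.height o (v.proj k) - 𝒯.height o (w.proj k)| ≤ 2 * (p.length : ℤ) := by
  induction p with
  | nil => simp
  | @cons v u w hvu p ih =>
    have hvu' := hvu
    obtain ⟨i, j, hij, hi, hj, hk⟩ := hvu'
    have hab : ∀ a b : T, 𝒯.graph.Adj a b → |𝒯.height o a - 𝒯.height o b| ≤ 1 := by
      intro a b hab
      rcases (𝒯.adj_iff a b).1 hab with rfl | rfl <;> simp [𝒯.height_pred]
    have : ∀ k ∈ Finset.univ, |𝒯.height o (v.proj k) - 𝒯.height o (w.proj k)| ≤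
        |𝒯.height o (u.proj k) - 𝒯.height o (w.proj k)| +
          ((if k = i then 1 else 0) + if k = j then 1 else 0) := by
      intro k _
      have hi := hab _ _ hi
      have hj := hab _ _ hj
      have htri := abs_sub_le (𝒯.height o (v.proj k)) (𝒯.height o (u.proj k))
        (𝒯.height o (w.proj k))
      split_ifs with h1 h2 h2
      · exact absurd (h1.symm.trans h2) hij
      · subst h1
        omega
      · subst h2
        omega
      · simp [hk k h1 h2]
    have := Finset.sum_le_sum this
    simp only [Finset.sum_add_distrib, Finset.sum_ite_eq', Finset.mem_univ, if_true] at this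
    rw [SimpleGraph.Walk.length_cons]
    push_cast
    omega

theorem reachable_of_eq_off (hd : 2 ≤ d) (i : Fin d) (v w : DLVertex 𝒯 o d)
    (h : ∀ k, k ≠ i → v.proj k = w.proj k) (hi : 𝒯.height o (v.proj i) = 𝒯.height o (w.proj i)) :
    (DLGraph 𝒯 o d).Reachable v w := by
  have : Nontrivial (Fin d) := Fin.nontrivial_iff_two_le.2 hd
  obtain ⟨j, hij⟩ := exists_ne i
  obtain ⟨n, hn⟩ := 𝒯.exists_iterate_pred_eq hi
  -- Raising coordinate `i` merges the two vertices, while coordinate `j` descends along the same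
  -- chosen successors in both.
  have : v.shift hij.symm n = w.shift hij.symm n := by
    ext k
    simp only [shift]
    split_ifs with h1 h2
    · rw [h1, hn]
    · rw [h k h1]
    · rw [h k h1]
  exact (v.reachable_shift hij.symm n).trans (this ▸ (w.reachable_shift hij.symm n).symm)

theorem reachable_of_height_eq (hd : 2 ≤ d) (w : DLVertex 𝒯 o d) (S : Finset (Fin d)) :
    ∀ v : DLVertex 𝒯 o d, (∀ k, 𝒯.height o (v.proj k) = 𝒯.height o (w.proj k)) →
      (∀ k ∉ S, v.proj k = w.proj k) → (DLGraph 𝒯 o d).Reachable v w := by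
  induction S using Finset.induction_on with
  | empty =>
    intro v _ h
    obtain rfl : v = w := DLVertex.ext (funext fun k => h k (Finset.notMem_empty k))
    rfl
  | insert a S ha ih =>
    intro v hv h
    have hu : ∀ k, 𝒯.height o (if k = a then w.proj k else v.proj k) = 𝒯.height o (w.proj k) := by
      intro k
      split_ifs
      · rfl
      · exact hv k
    let u : DLVertex 𝒯 o d := ⟨fun k => if k = a then w.proj k else v.proj k, by
      simp only [hu, w.sum_height]⟩
    refine (reachable_of_eq_off hd a v u (fun k hk => by simp [u, hk]) (by simp [u, hv])).trans
      (ih u hu fun k hk => ?_)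
    by_cases hka : k = a
    · simp [u, hka]
    · simp only [u, hka, if_false]
      exact h k (by simp [hka, hk])

end DLVertex

theorem DLGraph.connected {q : ℕ} {T : Type*} (𝒯 : DirectedRegularTree q T) (o : T) {d : ℕ}
    (hd : 2 ≤ d) : (DLGraph 𝒯 o d).Connected := by
  have : Nonempty (DLVertex 𝒯 o d) := ⟨DLVertex.base 𝒯 o d⟩
  refine ⟨fun v w => ?_⟩
  obtain ⟨v', hv', p, -⟩ := v.exists_walk_height_eq w
  exact p.reachable.trans
    (DLVertex.reachable_of_height_eq hd w Finset.univ v' hv' fun k hk =>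
      absurd (Finset.mem_univ k) hk)

/-! ### Distances for `q = 1`, and the shape of an edge. -/

namespace DLVertex

theorem two_mul_dist_of_one {T : Type*} {𝒯 : DirectedRegularTree 1 T} {o : T} {d : ℕ}
    (hd : 2 ≤ d) (v w : DLVertex 𝒯 o d) :
    2 * ((DLGraph 𝒯 o d).dist v w : ℤ) =
      ∑ k, |𝒯.height o (v.proj k) - 𝒯.height o (w.proj k)| := by
  refine le_antisymm ?_ ?_
  · obtain ⟨v', hv', p, hp⟩ := v.exists_walk_height_eq w
    obtain rfl : v' = w := DLVertex.ext (funext fun k => 𝒯.height_injective_of_one o (hv' k))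
    have := SimpleGraph.dist_le p
    omega
  · obtain ⟨p, hp⟩ := (DLGraph.connected 𝒯 o hd).exists_walk_length_eq_dist v w
    rw [← hp]
    exact sum_abs_sub_le v w p

variable {q : ℕ} {T : Type*} {𝒯 : DirectedRegularTree q T} {o : T} {d : ℕ}

/-- An edge along which the `i`-th coordinate goes up: some other coordinate goes down. -/
theorem exists_pred_eq_of_adj {v w : DLVertex 𝒯 o d} (h : (DLGraph 𝒯 o d).Adj v w) {i : Fin d}
    (hi : w.proj i = 𝒯.pred (v.proj i)) :
    ∃ a, a ≠ i ∧ v.proj a = 𝒯.pred (w.proj a) ∧ ∀ k, k ≠ i → k ≠ a → v.proj k = w.proj k := by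
  obtain ⟨a, hai, ha, hk⟩ : ∃ a, a ≠ i ∧ 𝒯.graph.Adj (v.proj a) (w.proj a) ∧
      ∀ k, k ≠ i → k ≠ a → v.proj k = w.proj k := by
    obtain ⟨i', j', hij, hi', hj', hk⟩ := h
    by_cases h1 : i' = i
    · exact ⟨j', fun h2 => hij (h1.trans h2.symm), hj', fun k h2 h3 => hk k (h1 ▸ h2) h3⟩
    · by_cases h2 : j' = i
      · exact ⟨i', h1, hi', fun k h3 h4 => hk k h4 (h2 ▸ h3)⟩
      · have := hk i (Ne.symm h1) (Ne.symm h2)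
        rw [hi] at this
        exact absurd this.symm (𝒯.pred_ne _)
  refine ⟨a, hai, ?_, hk⟩
  rcases (𝒯.adj_iff _ _).1 ha with h1 | h1
  · have := v.sum_height_add_ite (fun k => 𝒯.height o (w.proj k)) i a (-1) (-1) (by
      intro k
      split_ifs with h2 h3 h3
      · exact absurd (h3.symm.trans h2) hai
      · rw [h2, hi, 𝒯.height_pred]; ring
      · rw [h3, h1, 𝒯.height_pred]; ring
      · simp [hk k h2 h3])
    rw [w.sum_height] at this
    omega
  · exact h1

end DLVertex

/-! ### Test vertices for `q ≥ 2`. -/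

namespace DLVertex

variable {q : ℕ} {T : Type*} {𝒯 : DirectedRegularTree q T} {o : T} {d : ℕ}

/-- Folding the `i`-th coordinate. -/
noncomputable def foldHom (i : Fin d) {c b : T} {n : ℕ} (hb : 𝒯.height o b = 0)
    (hc : 𝒯.height o c = -n) (hbc : 𝒯.pred^[n + 1] b = 𝒯.pred c) :
    DLGraph 𝒯 o d →g DLGraph 𝒯 o d :=
  map (fun k v => if k = i then 𝒯.fold o c b v else v)
    (fun k v => by
      split_ifs
      · exact 𝒯.fold_pred hc hbc v
      · rfl)
    (fun v => by
      rw [← v.sum_height]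
      refine Finset.sum_congr rfl fun k _ => ?_
      split_ifs
      · exact 𝒯.height_fold hb _
      · rfl)

/-- Folding the `i`-th tree onto a line and moving it one step down, while the `j`-th coordinate
moves one step up. -/
noncomputable def lowerHom {i j : Fin d} (hij : i ≠ j) : DLGraph 𝒯 o d →g DLGraph 𝒯 o d :=
  map (fun k v => if k = i then 𝒯.line o (𝒯.height o v + 1) else if k = j then 𝒯.pred v else v)
    (fun k v => by
      split_ifs
      · rw [𝒯.pred_line, 𝒯.height_pred]
        congr 1
        ring
      · rfl
      · rfl)
    (fun v => by
      rw [v.sum_height_add_ite _ i j 1 (-1), add_neg_cancel]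
      intro k
      split_ifs with h1 h2
      · exact absurd (h1.symm.trans h2) hij
      · rw [𝒯.height_line, 𝒯.height_self]; ring
      · rw [𝒯.height_pred]; ring
      · simp)

/-- The vertex with `i`-th coordinate `b` and all other coordinates `o`. -/
def single (i : Fin d) {b : T} (hb : 𝒯.height o b = 0) : DLVertex 𝒯 o d where
  proj k := if k = i then b else o
  sum_height := Finset.sum_eq_zero fun k _ => by
    split_ifs
    · exact hb
    · exact 𝒯.height_self o

/-- Folding the subtree below `c` onto the line through `b` fixes `x` and carries the basepoint to
`single i hb`. -/
theorem dist_single_le (hd : 2 ≤ d) (i : Fin d) {c b : T} {n : ℕ} (hb : 𝒯.height o b = 0)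
    (hc : 𝒯.pred^[n] o = c) (hbc : 𝒯.pred^[n + 1] b = 𝒯.pred c) {x : DLVertex 𝒯 o d}
    (hx : ¬ 𝒯.IsAncestor c (x.proj i)) :
    (DLGraph 𝒯 o d).dist x (single i hb) ≤ (DLGraph 𝒯 o d).dist x (base 𝒯 o d) := by
  have hch : 𝒯.height o c = -n := by
    rw [← hc, 𝒯.height_iterate_pred, 𝒯.height_self, zero_sub]
  have h := (DLGraph.connected 𝒯 o hd).dist_map_le (foldHom i hb hch hbc) x (base 𝒯 o d)
  have h1 : foldHom i hb hch hbc x = x := by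
    ext k
    change (if k = i then _ else _) = _
    split_ifs with hk
    · subst hk; exact 𝒯.fold_of_not_isAncestor hx
    · rfl
  have h2 : foldHom i hb hch hbc (base 𝒯 o d) = single i hb := by
    ext k
    change (if k = i then _ else _) = (if k = i then _ else _)
    split_ifs with hk
    · change 𝒯.fold o c b o = b
      rw [𝒯.fold_of_isAncestor ⟨n, hc⟩, 𝒯.height_self, 𝒯.line_zero]
    · rfl
  rwa [h1, h2] at h

/-- A geodesic from `x` to `single i hb` leaves the subtree of `c` by an edge `x'y` and later enters
that of `c'` by an edge `y'z`. Reroute it to the basepoint: fold its last part, from `z` on, onto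
the line through `o`, and apply `lowerHom` to its middle part, so that coordinate `i` starts and
ends this part at `c` and the upward step of `j` made on `y'z` is already done. The edge `y'z` then
collapses and at least one step is saved. -/
theorem dist_base_lt (hd : 2 ≤ d) (i : Fin d) {c c' b : T} {n : ℕ} (hb : 𝒯.height o b = 0)
    (hc : 𝒯.pred^[n] o = c) (hbc : 𝒯.pred^[n] b = c') (hne : c' ≠ c)
    (hcc : 𝒯.pred c' = 𝒯.pred c) {x : DLVertex 𝒯 o d} (hx : 𝒯.IsAncestor c (x.proj i)) :
    (DLGraph 𝒯 o d).dist x (base 𝒯 o d) < (DLGraph 𝒯 o d).dist x (single i hb) := by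
  have hG := DLGraph.connected 𝒯 o hd
  have hch : 𝒯.height o c = -n := by
    rw [← hc, 𝒯.height_iterate_pred, 𝒯.height_self, zero_sub]
  have hch' : 𝒯.height o c' = -n := by
    rw [← hbc, 𝒯.height_iterate_pred, hb, zero_sub]
  have hbi : (single (d := d) i hb).proj i = b := if_pos rfl
  have hbc' : 𝒯.IsAncestor c' ((single (d := d) i hb).proj i) :=
    ⟨n, by rw [hbi, hbc]⟩
  obtain ⟨x', y, hx', hy, hadj, hle⟩ := hG.exists_adj_dist_add_le
    (fun v => 𝒯.IsAncestor c (v.proj i)) hx (z := single i hb)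
    (fun h => hne (hbc'.eq_of_height_eq (o := o) h (hch'.trans hch.symm)))
  obtain ⟨hx'c, hyu⟩ : x'.proj i = c ∧ y.proj i = 𝒯.pred c := by
    obtain ⟨i', j', -, hi', hj', hk⟩ := hadj
    by_cases h : i' = i
    · subst h; exact hx'.exit hy hi'
    · by_cases h2 : j' = i
      · subst h2; exact hx'.exit hy hj'
      · exact absurd (hk i (Ne.symm h) (Ne.symm h2) ▸ hx') hy
  obtain ⟨y', z, hy', hz, hadj', hle'⟩ := hG.exists_adj_dist_add_le
    (fun v => ¬ 𝒯.IsAncestor c' (v.proj i)) (x := y) (z := single i hb)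
    (by rw [hyu, ← hcc]; exact 𝒯.not_isAncestor_pred c') (not_not.2 hbc')
  rw [not_not] at hz
  obtain ⟨hzc, hyu'⟩ : z.proj i = c' ∧ y'.proj i = 𝒯.pred c' := by
    obtain ⟨i', j', -, hi', hj', hk⟩ := hadj'
    by_cases h : i' = i
    · subst h; exact hz.exit hy' hi'.symm
    · by_cases h2 : j' = i
      · subst h2; exact hz.exit hy' hj'.symm
      · exact absurd ((hk i (Ne.symm h) (Ne.symm h2)).symm ▸ hz) hy'
  obtain ⟨a, hai, ha, hak⟩ := exists_pred_eq_of_adj hadj (hyu.trans (by rw [hx'c]))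
  obtain ⟨j, hji, hj, hjk⟩ := exists_pred_eq_of_adj hadj'.symm (hyu'.trans (by rw [hzc]))
  set Φ : DLGraph 𝒯 o d →g DLGraph 𝒯 o d :=
    foldHom i (c := c') (b := o) (n := n) (𝒯.height_self o) hch'
      (by rw [Function.iterate_succ_apply', hc, hcc]) with hΦ
  set Ψ : DLGraph 𝒯 o d →g DLGraph 𝒯 o d := lowerHom (Ne.symm hji) with hΨ
  have hΦi : ∀ v : DLVertex 𝒯 o d, 𝒯.IsAncestor c' (v.proj i) →
      (Φ v).proj i = 𝒯.line o (𝒯.height o (v.proj i)) := fun v hv =>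
    (if_pos rfl).trans (𝒯.fold_of_isAncestor hv)
  have hΦk : ∀ v : DLVertex 𝒯 o d, ∀ k ≠ i, (Φ v).proj k = v.proj k := fun v k hk => if_neg hk
  have hΨi : ∀ v : DLVertex 𝒯 o d, v.proj i = 𝒯.pred c → (Ψ v).proj i = c := by
    intro v hv
    refine (if_pos rfl).trans ?_
    rw [hv, 𝒯.height_pred, hch, sub_add_cancel, 𝒯.line_neg_natCast, hc]
  have hΨj : ∀ v : DLVertex 𝒯 o d, (Ψ v).proj j = 𝒯.pred (v.proj j) := fun v =>
    (if_neg hji).trans (if_pos rfl)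
  have hΨk : ∀ v : DLVertex 𝒯 o d, ∀ k, k ≠ i → k ≠ j → (Ψ v).proj k = v.proj k :=
    fun v k hk hk' => (if_neg hk).trans (if_neg hk')
  have hend : Φ (single i hb) = base 𝒯 o d := by
    ext k
    by_cases hk : k = i
    · subst hk
      rw [hΦi _ hbc', hbi, hb, 𝒯.line_zero]
      rfl
    · rw [hΦk _ k hk]
      exact if_neg hk
  -- The modified middle and last parts fit together with no edge between them.
  have hmid : Ψ y' = Φ z := by
    ext k
    by_cases hk : k = i
    · subst hk
      rw [hΨi _ (hyu'.trans hcc), hΦi _ hz, hzc, hch', 𝒯.line_neg_natCast, hc]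
    · rw [hΦk _ k hk]
      by_cases hk' : k = j
      · subst hk'; rw [hΨj, hj]
      · rw [hΨk _ k hk hk', hjk k hk hk']
  -- On the edge `x'y` some coordinate `a` goes down. If `a = j`, that step cancels against the
  -- upward step of `j`; otherwise the two steps together form one edge.
  have hstep : (DLGraph 𝒯 o d).dist x' (Ψ y) ≤ 1 := by
    by_cases haj : a = j
    · subst haj
      have : x' = Ψ y := by
        ext k
        by_cases hk : k = i
        · subst hk; rw [hΨi _ hyu, hx'c]
        · by_cases hk' : k = a
          · subst hk'; rw [hΨj, ha]
          · rw [hΨk _ k hk hk', hak k hk hk']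
      rw [← this, SimpleGraph.dist_self]
      exact zero_le_one
    · have hadj1 : (DLGraph 𝒯 o d).Adj x' (Ψ y) := by
        refine ⟨a, j, haj, ?_, ?_, fun k hk hk' => ?_⟩
        · rw [ha, hΨk _ a hai haj]
          exact (𝒯.adj_pred _).symm
        · rw [hΨj, hak j hji (Ne.symm haj)]
          exact 𝒯.adj_pred _
        · by_cases hki : k = i
          · subst hki; rw [hΨi _ hyu, hx'c]
          · rw [hΨk _ k hki hk', hak k hki hk]
      exact (SimpleGraph.dist_eq_one_iff_adj.2 hadj1).le
  have h1 := hG.dist_map_le Ψ y y'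
  have h2 := hG.dist_map_le Φ z (single i hb)
  rw [hend, ← hmid] at h2
  have h3 := hG.dist_triangle (u := x) (v := x') (w := base 𝒯 o d)
  have h4 := hG.dist_triangle (u := x') (v := Ψ y) (w := base 𝒯 o d)
  have h5 := hG.dist_triangle (u := Ψ y) (v := Ψ y') (w := base 𝒯 o d)
  omega

/-! ### Test vertices for `q = 1`, and the two cases combined. -/

theorem m_le_iff_of_one {𝒯 : DirectedRegularTree 1 T} (i : Fin d) (x : DLVertex 𝒯 o d) (n : ℕ) :
    x.m i ≤ n ↔ -(n : ℤ) ≤ 𝒯.height o (x.proj i) := by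
  rw [m, 𝒯.m_le_iff]
  constructor
  · rintro ⟨k, hk⟩
    have := congrArg (𝒯.height o) hk
    rw [𝒯.height_iterate_pred, 𝒯.height_iterate_pred, 𝒯.height_self] at this
    omega
  · intro h
    refine ⟨(𝒯.height o (x.proj i) + n).toNat, 𝒯.height_injective_of_one o ?_⟩
    rw [𝒯.height_iterate_pred, 𝒯.height_iterate_pred, 𝒯.height_self]
    omega

theorem dist_shift_succ_of_one {𝒯 : DirectedRegularTree 1 T} (hd : 2 ≤ d) {i j : Fin d}
    (hij : i ≠ j) (x : DLVertex 𝒯 o d) (n : ℕ) :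
    2 * ((DLGraph 𝒯 o d).dist x ((base 𝒯 o d).shift hij (n + 1)) : ℤ) =
      2 * ((DLGraph 𝒯 o d).dist x ((base 𝒯 o d).shift hij n) : ℤ) +
        ((|𝒯.height o (x.proj i) + n + 1| - |𝒯.height o (x.proj i) + n|) +
          (|𝒯.height o (x.proj j) - n - 1| - |𝒯.height o (x.proj j) - n|)) := by
  rw [two_mul_dist_of_one hd, two_mul_dist_of_one hd]
  have : ∀ k, |𝒯.height o (x.proj k) - 𝒯.height o (((base 𝒯 o d).shift hij (n + 1)).proj k)| =
      |𝒯.height o (x.proj k) - 𝒯.height o (((base 𝒯 o d).shift hij n).proj k)| +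
        ((if k = i then |𝒯.height o (x.proj i) + n + 1| - |𝒯.height o (x.proj i) + n| else 0) +
          if k = j then |𝒯.height o (x.proj j) - n - 1| - |𝒯.height o (x.proj j) - n|
            else 0) := by
    intro k
    have hbase : 𝒯.height o ((base 𝒯 o d).proj k) = 0 := 𝒯.height_self o
    rw [height_shift, height_shift, hbase]
    split_ifs with h1 h2 h2
    · exact absurd (h1.symm.trans h2) hij
    · subst h1
      push_cast
      ring_nf
    · subst h2
      push_cast
      ring_nf
    · ring_nf
  rw [Finset.sum_congr rfl fun k _ => this k]
  simp [Finset.sum_add_distrib]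

/-- If all other heights were at least `n + 1`, the heights would sum to at least 1 instead of 0. -/
theorem exists_ne_height_le (hd : 2 ≤ d) (i : Fin d) (x : DLVertex 𝒯 o d) (n : ℕ)
    (h : -(n : ℤ) ≤ 𝒯.height o (x.proj i)) : ∃ j, i ≠ j ∧ 𝒯.height o (x.proj j) ≤ n := by
  have : Nontrivial (Fin d) := Fin.nontrivial_iff_two_le.2 hd
  obtain ⟨j, hji⟩ := exists_ne i
  by_contra! hall
  have hle : ∀ k ∈ Finset.univ,
      (if k = i then -(n : ℤ) else 0) + (if k = j then (n : ℤ) + 1 else 0) ≤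
        𝒯.height o (x.proj k) := by
    intro k _
    split_ifs with h1 h2 h2
    · exact absurd (h2.symm.trans h1) hji
    · subst h1
      omega
    · subst h2
      have := hall k (Ne.symm hji)
      omega
    · have := hall k (Ne.symm h1)
      omega
  have := Finset.sum_le_sum hle
  rw [x.sum_height] at this
  simp only [Finset.sum_add_distrib, Finset.sum_ite_eq', Finset.mem_univ, if_true] at this
  omega

/-- Bounds on `m_i` are detected by comparing finitely many distances. -/
theorem exists_m_le_iff_dist_lt (𝒯 : DirectedRegularTree q T) (o : T) (hd : 2 ≤ d) (i : Fin d)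
    (n : ℕ) :
    ∃ z z' : Fin d → DLVertex 𝒯 o d, ∀ x : DLVertex 𝒯 o d, x.m i ≤ n ↔
      ∃ j, (DLGraph 𝒯 o d).dist x (z j) < (DLGraph 𝒯 o d).dist x (z' j) := by
  by_cases hq : q = 1
  · subst hq
    -- The test compares the `n`-th and `(n+1)`-th shifts, `i` up and `j` down. The suitable `j`
    -- depends on `x`, so all are offered; for `j = i` both test vertices coincide and the strict
    -- inequality fails.
    refine ⟨fun j => if h : i ≠ j then (base 𝒯 o d).shift h n else base 𝒯 o d,
      fun j => if h : i ≠ j then (base 𝒯 o d).shift h (n + 1) else base 𝒯 o d, fun x => ?_⟩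
    rw [m_le_iff_of_one]
    constructor
    · intro h
      obtain ⟨j, hij, hj⟩ := x.exists_ne_height_le hd i n h
      refine ⟨j, ?_⟩
      have hdist := dist_shift_succ_of_one hd hij x n
      rw [abs_of_nonneg (by omega), abs_of_nonneg (by omega), abs_of_nonpos (by omega),
        abs_of_nonpos (by omega)] at hdist
      simp only [dif_pos hij]
      omega
    · rintro ⟨j, hj⟩
      by_cases hij : i ≠ j
      · simp only [dif_pos hij] at hj
        have hdist := dist_shift_succ_of_one hd hij x n
        by_contra! hlt
        rw [abs_of_nonpos (by omega), abs_of_nonpos (by omega)] at hdist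
        -- With `x_i` of height below `-n`, the further shift gains 1 in coordinate `i` and loses at
        -- most 1 in coordinate `j`, so the distance cannot grow.
        have := abs_sub (𝒯.height o (x.proj j) - n) 1
        rw [abs_one] at this
        omega
      · simp only [dif_neg hij, lt_self_iff_false] at hj
  · obtain ⟨c', hne, hcc⟩ := 𝒯.exists_ne_pred_eq hq (𝒯.pred^[n] o)
    -- The vertex `b` is found by descending `n` steps from the sibling `c'`, back to height 0.
    have hbc : 𝒯.pred^[n] (𝒯.succ^[n] c') = c' := 𝒯.iterate_pred_iterate_succ c' n
    have hb : 𝒯.height o (𝒯.succ^[n] c') = 0 := by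
      have h1 := congrArg (𝒯.height o) hcc
      rw [𝒯.height_pred, 𝒯.height_pred, 𝒯.height_iterate_pred, 𝒯.height_self] at h1
      rw [𝒯.height_iterate_succ]
      omega
    refine ⟨fun _ => base 𝒯 o d, fun _ => single i hb, fun x => ?_⟩
    rw [m, 𝒯.m_le_iff]
    constructor
    · exact fun h => ⟨i, dist_base_lt hd i hb rfl hbc hne hcc h⟩
    · rintro ⟨_, h⟩
      by_contra hx
      exact h.not_ge (dist_single_le hd i hb rfl
        (by rw [Function.iterate_succ_apply', hbc, hcc]) hx)

end DLVertex

/-! ### Passage to horofunctions. -/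

/-- The comparison of two distances from `x n` is eventually decided by the horofunction. -/
theorem DefinesHorofunction.eventually_dist_lt_iff {V : Type*} {G : SimpleGraph V} {x₀ : V}
    {x : ℕ → V} {h : V → ℝ} (hx : DefinesHorofunction G x₀ x h) (z z' : V) :
    ∀ᶠ n in atTop, (G.dist (x n) z < G.dist (x n) z' ↔ h z < h z') := by
  have hlim : Tendsto (fun n => (G.dist (x n) z' : ℝ) - G.dist (x n) z) atTop
      (𝓝 (h z' - h z)) := by
    refine ((hx z').sub (hx z)).congr fun n => ?_
    ring
  by_cases hlt : h z < h z'
  · filter_upwards [hlim.eventually_const_lt (sub_pos.2 hlt)] with n hn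
    simp only [hlt, iff_true]
    exact_mod_cast sub_pos.1 hn
  -- The limit is at most 0, so the integer difference is eventually below 1, hence at most 0; this
  -- covers equality `h z = h z'` as well.
  · filter_upwards [hlim.eventually_lt_const (u := 1) (by linarith)] with n hn
    simp only [hlt, iff_false, not_lt]
    rw [sub_lt_iff_lt_add'] at hn
    exact Nat.lt_succ_iff.1 (by exact_mod_cast hn)

/-- All sequences defining the same horofunction have the same limit of `m_i`. -/
theorem exists_forall_hasMLimit {q : ℕ} {T : Type*} (𝒯 : DirectedRegularTree q T) (o : T) {d : ℕ}
    (hd : 2 ≤ d) (i : Fin d) (h : DLVertex 𝒯 o d → ℝ) :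
    ∃ M : ℕ∞, ∀ x : ℕ → DLVertex 𝒯 o d,
      DefinesHorofunction (DLGraph 𝒯 o d) (DLVertex.base 𝒯 o d) x h → HasMLimit i x M := by
  classical
  choose z z' hz using DLVertex.exists_m_le_iff_dist_lt 𝒯 o hd i
  have hev : ∀ x : ℕ → DLVertex 𝒯 o d,
      DefinesHorofunction (DLGraph 𝒯 o d) (DLVertex.base 𝒯 o d) x h →
        ∀ n, ∀ᶠ t in atTop, ((x t).m i ≤ n ↔ ∃ j, h (z n j) < h (z' n j)) := by
    intro x hx n
    filter_upwards [eventually_all.2 fun j => hx.eventually_dist_lt_iff (z n j) (z' n j)] with t ht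
    rw [hz]
    exact exists_congr ht
  -- The limit is the least `n` whose test `h` passes, and `⊤` if there is none.
  by_cases hex : ∃ n, ∃ j, h (z n j) < h (z' n j)
  · refine ⟨(Nat.find hex : ℕ), fun x hx => ?_⟩
    refine tendsto_const_nhds.congr' ?_
    have hlow : ∀ᶠ t in atTop, ∀ k : Fin (Nat.find hex), ¬ (x t).m i ≤ k :=
      eventually_all.2 fun k => (hev x hx k).mono fun t ht => by
        rw [ht]
        exact Nat.find_min hex k.2
    filter_upwards [hev x hx (Nat.find hex), hlow] with t h1 h2
    have h3 := h1.2 (Nat.find_spec hex)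
    have h4 : Nat.find hex ≤ (x t).m i := by
      by_contra! hlt
      exact h2 ⟨_, hlt⟩ le_rfl
    rw [le_antisymm h4 h3]
  · refine ⟨⊤, fun x hx => ENat.tendsto_nhds_top_iff_natCast_lt.2 fun n => ?_⟩
    filter_upwards [hev x hx n] with t ht
    have := mt ht.1 fun hj => hex ⟨n, hj⟩
    exact_mod_cast not_le.1 this

theorem mainTheorem3 {q : ℕ} {T : Type*} (𝒯 : DirectedRegularTree q T) (o : T)
    (d : ℕ) (hd : 2 ≤ d) :
    (∀ (x : ℕ → DLVertex 𝒯 o d) (h : DLVertex 𝒯 o d → ℝ),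
      DefinesHorofunction (DLGraph 𝒯 o d) (DLVertex.base 𝒯 o d) x h →
        ∀ i : Fin d, ∃ M : ℕ∞, HasMLimit i x M) ∧
    (∀ (y z : ℕ → DLVertex 𝒯 o d) (hy hz : DLVertex 𝒯 o d → ℝ),
      DefinesHorofunction (DLGraph 𝒯 o d) (DLVertex.base 𝒯 o d) y hy →
      DefinesHorofunction (DLGraph 𝒯 o d) (DLVertex.base 𝒯 o d) z hz →
        (∃ (i : Fin d) (M N : ℕ∞), HasMLimit i y M ∧ HasMLimit i z N ∧ M ≠ N) → hy ≠ hz) ∧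
    (∀ h : DLVertex 𝒯 o d → ℝ,
      IsHorofunction (DLGraph 𝒯 o d) (DLVertex.base 𝒯 o d) h →
        ∀ i : Fin d, ∃! M : ℕ∞, ∀ x : ℕ → DLVertex 𝒯 o d,
          DefinesHorofunction (DLGraph 𝒯 o d) (DLVertex.base 𝒯 o d) x h → HasMLimit i x M) := by
  refine ⟨fun x h hx i => ?_, ?_, ?_⟩
  · obtain ⟨M, hM⟩ := exists_forall_hasMLimit 𝒯 o hd i h
    exact ⟨M, hM x hx⟩
  · rintro y z h _ hy hz ⟨i, M, N, hM, hN, hne⟩ rfl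
    obtain ⟨L, hL⟩ := exists_forall_hasMLimit 𝒯 o hd i h
    exact hne ((tendsto_nhds_unique hM (hL y hy)).trans (tendsto_nhds_unique (hL z hz) hN))
  · rintro h ⟨x, hx⟩ i
    obtain ⟨M, hM⟩ := exists_forall_hasMLimit 𝒯 o hd i h
    exact ⟨M, hM, fun N hN => tendsto_nhds_unique (hN x hx) (hM x hx)⟩
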